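/- Consider the simply typed $\lambda$-calculus with types $A,B ::= o \mid A\to B\mid A\times B\mid 1$ and terms built from variables, $\lambda(x:A).\,t$, application, pairs $\langle t,u\rangle$, projections $t_1,t_2$ and the unit element $\langle\rangle : 1$, with the usual typing and $\beta\eta$-conversion rules (including the $\eta$-rules for $\times$ and $1$). Let $\mathrm{Tm}(A)$ be the set of closed terms of type $A$ modulo $\beta\eta$-conversion; a language of type $A$ is a subset $L\subseteq \mathrm{Tm}(A)$. For a set $Q$, let $[\![A]\!]_Q$ be the standard set-theoretic interpretation of $A$: $[\![o]\!]_Q=Q$, $[\![A\to B]\!]_Q$ is the set of all functions $[\![A]\!]_Q\to[\![B]\!]_Q$, $[\![A\times B]\!]_Q=[\![A]\!]_Q\times[\![B]\!]_Q$, and $[\![1]\!]_Q$ is a one-point set; let $[\![t]\!]_Q\in[\![A]\!]_Q$ be the interpretation of $t\in\mathrm{Tm}(A)$. A language $L\subseteq\mathrm{Tm}(A)$ is recognized by $\mathbf{FinSet}$ if there are a finite set $Q$ and a subset $F\subseteq[\![A]\!]_Q$ with $L=\{t\in\mathrm{Tm}(A)\mid[\![t]\!]_Q\in F\}$. For types $A,B$,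 let $A[B]$ be $A$ with every occurrence of $o$ replaced by $B$, and for $t\in\mathrm{Tm}(A)$ let $t[B]\in\mathrm{Tm}(A[B])$ be obtained from $t$ by the same replacement in all type annotations. Let $\mathsf{Bool}=(o\times o)\to o$ and $\mathsf{true}=\lambda(x:o\times o).\,x_1$. A language $L\subseteq\mathrm{Tm}(A)$ is syntactically recognizable (in the sense of Hillebrand and Kanellakis) if there are a type $B$ and a closed term $r$ of type $A[B]\to\mathsf{Bool}$ such that $L=\{t\in\mathrm{Tm}(A)\mid r\,t[B]=_{\beta\eta}\mathsf{true}\}$. **Theorem.** For every simple type $A$, every language $L\subseteq\mathrm{Tm}(A)$ that is recognized by $\mathbf{FinSet}$ is syntactically recognizable. -/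

import Mathlib

/-! Simply typed lambda-calculus with products and unit over one base type, its closed terms modulo
beta-eta-conversion, its semantics in finite sets, and the two notions of recognizable language. -/

universe u

namespace STLC

/-- Simple types: the base type `o`, arrows, binary products and the unit type. -/
inductive Ty : Type
  | o : Ty
  | arr : Ty → Ty → Ty
  | prod : Ty → Ty → Ty
  | unit : Ty

/-- `A.cast B` is the type `A[B]`: every occurrence of `o` in `A` is replaced by `B`. -/
def Ty.cast (B : Ty) : Ty → Ty
  | .o => B
  | .arr A C => .arr (Ty.cast B A) (Ty.cast B C)
  | .prod A C => .prod (Ty.cast B A) (Ty.cast B C)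
  | .unit => .unit

/-- Typed de Bruijn variables: `Var Γ A` is the type of positions of `A` in the context `Γ`. -/
inductive Var : List Ty → Ty → Type
  | zero {Γ : List Ty} {A : Ty} : Var (A :: Γ) A
  | succ {Γ : List Ty} {A B : Ty} : Var Γ A → Var (B :: Γ) A

/-- Well-typed terms `Γ ⊢ t : A`; variables are de Bruijn indices, so terms are taken up to
renaming of bound variables. -/
inductive Term : List Ty → Ty → Type
  | var {Γ : List Ty} {A : Ty} : Var Γ A → Term Γ A
  | lam {Γ : List Ty} {A B : Ty} : Term (A :: Γ) B → Term Γ (.arr A B)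
  | app {Γ : List Ty} {A B : Ty} : Term Γ (.arr A B) → Term Γ A → Term Γ B
  | pair {Γ : List Ty} {A B : Ty} : Term Γ A → Term Γ B → Term Γ (.prod A B)
  | fst {Γ : List Ty} {A B : Ty} : Term Γ (.prod A B) → Term Γ A
  | snd {Γ : List Ty} {A B : Ty} : Term Γ (.prod A B) → Term Γ B
  | star {Γ : List Ty} : Term Γ .unit

/-- Renamings from the context `Γ` to the context `Δ`. -/
abbrev Ren (Γ Δ : List Ty) : Type := ∀ A : Ty, Var Γ A → Var Δ A

/-- Simultaneous substitutions of terms in context `Δ` for the variables of `Γ`. -/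
abbrev Sub (Γ Δ : List Ty) : Type := ∀ A : Ty, Var Γ A → Term Δ A

/-- A renaming extended under a binder. -/
def Ren.lift {Γ Δ : List Ty} (ρ : Ren Γ Δ) (B : Ty) : Ren (B :: Γ) (B :: Δ)
  | _, .zero => .zero
  | _, .succ x => .succ (ρ _ x)

/-- The action of a renaming on terms. -/
def Term.rename : {Γ Δ : List Ty} → {A : Ty} → Ren Γ Δ → Term Γ A → Term Δ A
  | _, _, _, ρ, .var x => .var (ρ _ x)
  | _, _, _, ρ, .lam t => .lam (t.rename (ρ.lift _))
  | _, _, _, ρ, .app t s => .app (t.rename ρ) (s.rename ρ)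
  | _, _, _, ρ, .pair t s => .pair (t.rename ρ) (s.rename ρ)
  | _, _, _, ρ, .fst t => .fst (t.rename ρ)
  | _, _, _, ρ, .snd t => .snd (t.rename ρ)
  | _, _, _, _, .star => .star

/-- Weakening by one fresh variable. -/
def Term.weaken {Γ : List Ty} {A : Ty} (B : Ty) (t : Term Γ A) : Term (B :: Γ) A :=
  t.rename (fun _ x => .succ x)

/-- A substitution extended under a binder. -/
def Sub.lift {Γ Δ : List Ty} (σ : Sub Γ Δ) (B : Ty) : Sub (B :: Γ) (B :: Δ)
  | _, .zero => .var .zero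
  | _, .succ x => (σ _ x).weaken B

/-- Capture-avoiding simultaneous substitution. -/
def Term.subst : {Γ Δ : List Ty} → {A : Ty} → Sub Γ Δ → Term Γ A → Term Δ A
  | _, _, _, σ, .var x => σ _ x
  | _, _, _, σ, .lam t => .lam (t.subst (σ.lift _))
  | _, _, _, σ, .app t s => .app (t.subst σ) (s.subst σ)
  | _, _, _, σ, .pair t s => .pair (t.subst σ) (s.subst σ)
  | _, _, _, σ, .fst t => .fst (t.subst σ)
  | _, _, _, σ, .snd t => .snd (t.subst σ)
  | _, _, _, _, .star => .star

/-- The substitution of `s` for the most recent variable, all others being fixed. -/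
def Sub.single {Γ : List Ty} {B : Ty} (s : Term Γ B) : Sub (B :: Γ) Γ
  | _, .zero => s
  | _, .succ x => .var x

/-- `t.inst s` is `t` with `s` substituted for its most recent variable. -/
def Term.inst {Γ : List Ty} {A B : Ty} (t : Term (B :: Γ) A) (s : Term Γ B) : Term Γ A :=
  t.subst (Sub.single s)

/-- Typed beta-eta-conversion, the least congruence that contains the beta and eta rules for
arrows, products and the unit type. -/
inductive Conv : {Γ : List Ty} → {A : Ty} → Term Γ A → Term Γ A → Prop
  | refl {Γ : List Ty} {A : Ty} (t : Term Γ A) : Conv t t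
  | symm {Γ : List Ty} {A : Ty} {t s : Term Γ A} : Conv t s → Conv s t
  | trans {Γ : List Ty} {A : Ty} {t s r : Term Γ A} : Conv t s → Conv s r → Conv t r
  | lam {Γ : List Ty} {A B : Ty} {t t' : Term (A :: Γ) B} :
      Conv t t' → Conv (.lam t) (.lam t')
  | app {Γ : List Ty} {A B : Ty} {t t' : Term Γ (.arr A B)} {s s' : Term Γ A} :
      Conv t t' → Conv s s' → Conv (.app t s) (.app t' s')
  | pair {Γ : List Ty} {A B : Ty} {t t' : Term Γ A} {s s' : Term Γ B} :
      Conv t t' → Conv s s' → Conv (.pair t s) (.pair t' s')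
  | fst {Γ : List Ty} {A B : Ty} {t t' : Term Γ (.prod A B)} :
      Conv t t' → Conv (.fst t) (.fst t')
  | snd {Γ : List Ty} {A B : Ty} {t t' : Term Γ (.prod A B)} :
      Conv t t' → Conv (.snd t) (.snd t')
  | beta {Γ : List Ty} {A B : Ty} (t : Term (A :: Γ) B) (s : Term Γ A) :
      Conv (.app (.lam t) s) (t.inst s)
  | eta {Γ : List Ty} {A B : Ty} (t : Term Γ (.arr A B)) :
      Conv (.lam (.app (t.weaken A) (.var .zero))) t
  | beta_fst {Γ : List Ty} {A B : Ty} (t : Term Γ A) (s : Term Γ B) :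
      Conv (.fst (.pair t s)) t
  | beta_snd {Γ : List Ty} {A B : Ty} (t : Term Γ A) (s : Term Γ B) :
      Conv (.snd (.pair t s)) s
  | eta_pair {Γ : List Ty} {A B : Ty} (t : Term Γ (.prod A B)) :
      Conv (.pair (.fst t) (.snd t)) t
  | eta_unit {Γ : List Ty} (t : Term Γ .unit) : Conv .star t

/-- Beta-eta-conversion as an equivalence relation on the closed terms of type `A`. -/
instance convSetoid (A : Ty) : Setoid (Term [] A) where
  r := Conv
  iseqv := ⟨Conv.refl, Conv.symm, Conv.trans⟩

/-- The set of closed terms of type `A` modulo beta-eta-conversion. -/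
def Tm (A : Ty) : Type := Quotient (convSetoid A)

/-- The class of a closed term. -/
def Tm.mk {A : Ty} (t : Term [] A) : Tm A := Quotient.mk (convSetoid A) t

/-- Application of closed terms modulo beta-eta-conversion. -/
def Tm.app {A B : Ty} : Tm (.arr A B) → Tm A → Tm B :=
  Quotient.map₂ Term.app (fun _ _ h _ _ h' => Conv.app h h')

/-! ### Type substitution in terms -/

/-- The variable `x : A` of `Γ`, seen as a variable of type `A[B]` of `Γ[B]`. -/
def Var.cast (B : Ty) : {Γ : List Ty} → {A : Ty} → Var Γ A → Var (Γ.map (Ty.cast B)) (Ty.cast B A)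
  | _, _, .zero => .zero
  | _, _, .succ x => .succ (Var.cast B x)

/-- The term `t[B]`, obtained from `t` by replacing `o` by `B` in all types. -/
def Term.cast (B : Ty) :
    {Γ : List Ty} → {A : Ty} → Term Γ A → Term (Γ.map (Ty.cast B)) (Ty.cast B A)
  | _, _, .var x => .var (Var.cast B x)
  | _, _, .lam t => .lam (Term.cast B t)
  | _, _, .app t s => .app (Term.cast B t) (Term.cast B s)
  | _, _, .pair t s => .pair (Term.cast B t) (Term.cast B s)
  | _, _, .fst t => .fst (Term.cast B t)
  | _, _, .snd t => .snd (Term.cast B t)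
  | _, _, .star => .star

theorem Term.cast_rename (B : Ty) {Γ : List Ty} {A : Ty} (t : Term Γ A) :
    ∀ {Δ : List Ty} (ρ : Ren Γ Δ) (ρ' : Ren (Γ.map (Ty.cast B)) (Δ.map (Ty.cast B))),
      (∀ C (x : Var Γ C), ρ' _ (Var.cast B x) = Var.cast B (ρ _ x)) →
      Term.cast B (t.rename ρ) = (Term.cast B t).rename ρ' := by
  induction t with
  | var x => intro Δ ρ ρ' h; simp [Term.rename, Term.cast, h]
  | lam t ih =>
    intro Δ ρ ρ' h
    simp only [Term.rename, Term.cast]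
    rw [ih (ρ.lift _) (ρ'.lift _)]
    intro C x
    cases x with
    | zero => rfl
    | succ x => simp [Var.cast, Ren.lift, h]
  | app t s iht ihs =>
    intro Δ ρ ρ' h
    exact congrArg₂ Term.app (iht ρ ρ' h) (ihs ρ ρ' h)
  | pair t s iht ihs =>
    intro Δ ρ ρ' h
    exact congrArg₂ Term.pair (iht ρ ρ' h) (ihs ρ ρ' h)
  | fst t ih => intro Δ ρ ρ' h; exact congrArg Term.fst (ih ρ ρ' h)
  | snd t ih => intro Δ ρ ρ' h; exact congrArg Term.snd (ih ρ ρ' h)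
  | star => intro Δ ρ ρ' h; rfl

theorem Term.cast_weaken (B C : Ty) {Γ : List Ty} {A : Ty} (t : Term Γ A) :
    Term.cast B (t.weaken C) = (Term.cast B t).weaken (Ty.cast B C) :=
  Term.cast_rename B t _ _ (fun _ _ => rfl)

theorem Term.cast_subst (B : Ty) {Γ : List Ty} {A : Ty} (t : Term Γ A) :
    ∀ {Δ : List Ty} (σ : Sub Γ Δ) (σ' : Sub (Γ.map (Ty.cast B)) (Δ.map (Ty.cast B))),
      (∀ C (x : Var Γ C), σ' _ (Var.cast B x) = Term.cast B (σ _ x)) →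
      Term.cast B (t.subst σ) = (Term.cast B t).subst σ' := by
  induction t with
  | var x => intro Δ σ σ' h; simp [Term.subst, Term.cast, h]
  | lam t ih =>
    intro Δ σ σ' h
    simp only [Term.subst, Term.cast]
    rw [ih (σ.lift _) (σ'.lift _)]
    intro C x
    cases x with
    | zero => rfl
    | succ x =>
      simp only [Var.cast, Sub.lift, h]
      exact (Term.cast_weaken B _ _).symm
  | app t s iht ihs =>
    intro Δ σ σ' h
    exact congrArg₂ Term.app (iht σ σ' h) (ihs σ σ' h)
  | pair t s iht ihs =>
    intro Δ σ σ' h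
    exact congrArg₂ Term.pair (iht σ σ' h) (ihs σ σ' h)
  | fst t ih => intro Δ σ σ' h; exact congrArg Term.fst (ih σ σ' h)
  | snd t ih => intro Δ σ σ' h; exact congrArg Term.snd (ih σ σ' h)
  | star => intro Δ σ σ' h; rfl

theorem Term.cast_inst (B : Ty) {Γ : List Ty} {A C : Ty} (t : Term (C :: Γ) A) (s : Term Γ C) :
    Term.cast B (t.inst s) = Term.inst (Term.cast B t) (Term.cast B s) := by
  refine Term.cast_subst B t _ _ ?_
  intro D x
  cases x with
  | zero => rfl
  | succ x => rfl

theorem Conv.cast (B : Ty) {Γ : List Ty} {A : Ty} {t s : Term Γ A} (h : Conv t s) :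
    Conv (Term.cast B t) (Term.cast B s) := by
  induction h with
  | refl t => exact .refl _
  | symm _ ih => exact .symm ih
  | trans _ _ ih ih' => exact .trans ih ih'
  | lam _ ih => exact .lam ih
  | app _ _ ih ih' => exact .app ih ih'
  | pair _ _ ih ih' => exact .pair ih ih'
  | fst _ ih => exact .fst ih
  | snd _ ih => exact .snd ih
  | beta t s => rw [Term.cast_inst]; exact .beta _ _
  | eta t =>
    simp only [Term.cast]
    rw [Term.cast_weaken]
    exact .eta _
  | beta_fst t s => exact .beta_fst _ _
  | beta_snd t s => exact .beta_snd _ _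
  | eta_pair t => exact .eta_pair _
  | eta_unit t => exact .eta_unit _

/-- The map `t ↦ t[B]` on closed terms modulo beta-eta-conversion. -/
def Tm.cast (B : Ty) {A : Ty} : Tm A → Tm (Ty.cast B A) :=
  Quotient.map (sa := convSetoid A) (sb := convSetoid (Ty.cast B A)) (Term.cast B)
    (fun _ _ h => Conv.cast B h)

/-! ### Semantics in sets -/

/-- The set-theoretic interpretation of a type, with base type interpreted by `Q`. -/
def Ty.den (Q : Type u) : Ty → Type u
  | .o => Q
  | .arr A B => Ty.den Q A → Ty.den Q B
  | .prod A B => Ty.den Q A × Ty.den Q B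
  | .unit => PUnit

/-- Valuations of the variables of a context. -/
abbrev Env (Q : Type u) (Γ : List Ty) : Type u := ∀ A : Ty, Var Γ A → Ty.den Q A

/-- Extension of a valuation by a value for a new variable. -/
def Env.cons {Q : Type u} {Γ : List Ty} {B : Ty} (e : Env Q Γ) (b : Ty.den Q B) : Env Q (B :: Γ)
  | _, .zero => b
  | _, .succ x => e _ x

/-- The set-theoretic interpretation of a term. -/
def Term.den (Q : Type u) : {Γ : List Ty} → {A : Ty} → Term Γ A → Env Q Γ → Ty.den Q A
  | _, _, .var x, e => e _ x
  | _, _, .lam t, e => fun a => Term.den Q t (e.cons a)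
  | _, _, .app t s, e => (Term.den Q t e) (Term.den Q s e)
  | _, _, .pair t s, e => (Term.den Q t e, Term.den Q s e)
  | _, _, .fst t, e => (Term.den Q t e).1
  | _, _, .snd t, e => (Term.den Q t e).2
  | _, _, .star, _ => PUnit.unit

theorem Term.den_rename (Q : Type u) {Γ : List Ty} {A : Ty} (t : Term Γ A) :
    ∀ {Δ : List Ty} (ρ : Ren Γ Δ) (e : Env Q Δ),
      Term.den Q (t.rename ρ) e = Term.den Q t (fun C x => e C (ρ C x)) := by
  induction t with
  | var x => intro Δ ρ e; rfl
  | lam t ih =>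
    intro Δ ρ e
    funext a
    simp only [Term.rename, Term.den, ih]
    congr 1
    funext C x
    cases x with
    | zero => rfl
    | succ x => rfl
  | app t s iht ihs => intro Δ ρ e; simp [Term.rename, Term.den, iht, ihs]
  | pair t s iht ihs => intro Δ ρ e; exact congrArg₂ Prod.mk (iht ρ e) (ihs ρ e)
  | fst t ih => intro Δ ρ e; simp [Term.rename, Term.den, ih]
  | snd t ih => intro Δ ρ e; simp [Term.rename, Term.den, ih]
  | star => intro Δ ρ e; rfl

theorem Term.den_weaken (Q : Type u) {Γ : List Ty} {A B : Ty} (t : Term Γ A) (e : Env Q Γ)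
    (b : Ty.den Q B) : Term.den Q (t.weaken B) (e.cons b) = Term.den Q t e :=
  Term.den_rename Q t _ _

theorem Term.den_subst (Q : Type u) {Γ : List Ty} {A : Ty} (t : Term Γ A) :
    ∀ {Δ : List Ty} (σ : Sub Γ Δ) (e : Env Q Δ),
      Term.den Q (t.subst σ) e = Term.den Q t (fun C x => Term.den Q (σ C x) e) := by
  induction t with
  | var x => intro Δ σ e; rfl
  | lam t ih =>
    intro Δ σ e
    funext a
    simp only [Term.subst, Term.den, ih]
    congr 1
    funext C x
    cases x with
    | zero => rfl
    | succ x => exact Term.den_weaken Q _ _ _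
  | app t s iht ihs => intro Δ σ e; simp [Term.subst, Term.den, iht, ihs]
  | pair t s iht ihs => intro Δ σ e; exact congrArg₂ Prod.mk (iht σ e) (ihs σ e)
  | fst t ih => intro Δ σ e; simp [Term.subst, Term.den, ih]
  | snd t ih => intro Δ σ e; simp [Term.subst, Term.den, ih]
  | star => intro Δ σ e; rfl

theorem Conv.den_eq (Q : Type u) {Γ : List Ty} {A : Ty} {t s : Term Γ A} (h : Conv t s) :
    Term.den Q t = Term.den Q s := by
  induction h with
  | refl t => rfl
  | symm _ ih => exact ih.symm
  | trans _ _ ih ih' => exact ih.trans ih'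
  | lam _ ih => funext e a; simp [Term.den, ih]
  | app _ _ ih ih' => funext e; simp [Term.den, ih, ih']
  | pair _ _ ih ih' => funext e; exact congrArg₂ Prod.mk (congrFun ih e) (congrFun ih' e)
  | fst _ ih => funext e; simp [Term.den, ih]
  | snd _ ih => funext e; simp [Term.den, ih]
  | beta t s =>
    funext e
    simp only [Term.den, Term.inst, Term.den_subst]
    congr 1
    funext C x
    cases x with
    | zero => rfl
    | succ x => rfl
  | eta t =>
    funext e a
    simp only [Term.den, Term.den_weaken]
    rfl
  | beta_fst t s => rfl
  | beta_snd t s => rfl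
  | eta_pair t => rfl
  | eta_unit t => rfl

/-- The unique valuation of the empty context. -/
def Env.nil (Q : Type u) : Env Q [] := fun _ x => nomatch x

/-- The semantic bracket, from closed terms of type `A` modulo beta-eta-conversion to the
set-theoretic interpretation of `A`. -/
def Tm.den (Q : Type u) {A : Ty} : Tm A → Ty.den Q A :=
  Quotient.lift (fun t : Term [] A => Term.den Q t (Env.nil Q))
    (fun _ _ h => congrFun (Conv.den_eq Q h) (Env.nil Q))

/-! ### Recognizable languages -/

/-- The language of closed terms of type `A` determined by a subset `F` of the interpretation
of `A` at `Q`. -/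
def langOf (Q : Type u) {A : Ty} (F : Set (Ty.den Q A)) : Set (Tm A) :=
  {t | Tm.den Q t ∈ F}

/-- A language of closed terms is recognized by finite sets if it is determined by a subset of
the interpretation of its type at some finite set. -/
def FinSetRecognizable {A : Ty} (L : Set (Tm A)) : Prop :=
  ∃ (Q : Type u) (_ : Finite Q) (F : Set (Ty.den Q A)), L = langOf Q F

/-- The type of Booleans, `o × o → o`. -/
def Ty.bool : Ty := .arr (.prod .o .o) .o

/-- The Boolean "true", the first projection. -/
def Tm.tt : Tm Ty.bool := Tm.mk (.lam (.fst (.var .zero)))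

/-- Syntactic recognizability in the sense of Hillebrand and Kanellakis. -/
def SyntacticallyRecognizable {A : Ty} (L : Set (Tm A)) : Prop :=
  ∃ (B : Ty) (r : Tm (.arr (Ty.cast B A) Ty.bool)),
    L = {t | Tm.app r (Tm.cast B t) = Tm.tt}

end STLC

/-! A finite set `Q` with `n` elements is encoded by the type `B = oⁿ → o`, its elements by the
projections. A logical relation `Rel` between `⟦A⟧_Q` and the terms of type `A[B]`, which at `o`
relates an element to the projection encoding it, contains `(⟦t⟧, t[B])` for every closed term `t`
(`rel_den_cast`). Thus it suffices to show that a term of type `A[B]` that is related to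
`a ∈ ⟦A⟧_Q` can be inspected, inside the calculus, to the point of determining `a`.

This is done by recursion on `A`, together with the definability of all elements of `⟦A⟧_Q`.
`quote a` is a term related to `a`, and `caseOf t k` is a term which is convertible to `k a`
whenever `t` is related to `a`. A function `f : ⟦A⟧_Q → ⟦C⟧_Q` is quoted as the term that inspects
its argument `a` and returns the quotation of `f a`; a term of type `(A → C)[B]` is inspected by
inspecting its values at the quotations of all the finitely many elements of `⟦A⟧_Q`. Case
distinctions with results in an arbitrary type reduce to those with results in `o` by η-expansion
(`select`).

The recognizing term for `F ⊆ ⟦A⟧_Q` inspects its argument and returns the Boolean telling whether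
the element found lies in `F`. -/

namespace STLC

/-! ### Renamings and substitutions -/

theorem Term.rename_rename {Γ : List Ty} {A : Ty} (t : Term Γ A) :
    ∀ {Δ Θ : List Ty} (ρ : Ren Γ Δ) (ρ' : Ren Δ Θ) (ρ'' : Ren Γ Θ),
      (∀ C (x : Var Γ C), ρ' _ (ρ _ x) = ρ'' _ x) → (t.rename ρ).rename ρ' = t.rename ρ'' := by
  induction t with
  | var x => intro Δ Θ ρ ρ' ρ'' h; simp [Term.rename, h]
  | lam t ih =>
    intro Δ Θ ρ ρ' ρ'' h
    simp only [Term.rename]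
    rw [ih (ρ.lift _) (ρ'.lift _) (ρ''.lift _)]
    intro C x
    cases x with
    | zero => rfl
    | succ x => simp [Ren.lift, h]
  | app t s iht ihs =>
    intro Δ Θ ρ ρ' ρ'' h
    exact congrArg₂ Term.app (iht ρ ρ' ρ'' h) (ihs ρ ρ' ρ'' h)
  | pair t s iht ihs =>
    intro Δ Θ ρ ρ' ρ'' h
    exact congrArg₂ Term.pair (iht ρ ρ' ρ'' h) (ihs ρ ρ' ρ'' h)
  | fst t ih => intro Δ Θ ρ ρ' ρ'' h; exact congrArg Term.fst (ih ρ ρ' ρ'' h)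
  | snd t ih => intro Δ Θ ρ ρ' ρ'' h; exact congrArg Term.snd (ih ρ ρ' ρ'' h)
  | star => intros; rfl

theorem Term.weaken_rename_lift {Γ Δ : List Ty} {A : Ty} (t : Term Γ A) (ρ : Ren Γ Δ) (B : Ty) :
    (t.weaken B).rename (ρ.lift B) = (t.rename ρ).weaken B :=
  (Term.rename_rename t _ _ _ fun _ _ => rfl).trans
    (Term.rename_rename t ρ (fun _ x => .succ x) (fun _ x => .succ (ρ _ x)) fun _ _ => rfl).symm

theorem Term.subst_rename {Γ : List Ty} {A : Ty} (t : Term Γ A) :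
    ∀ {Δ Θ : List Ty} (ρ : Ren Γ Δ) (σ : Sub Δ Θ) (τ : Sub Γ Θ),
      (∀ C (x : Var Γ C), σ _ (ρ _ x) = τ _ x) → (t.rename ρ).subst σ = t.subst τ := by
  induction t with
  | var x => intro Δ Θ ρ σ τ h; simp [Term.rename, Term.subst, h]
  | lam t ih =>
    intro Δ Θ ρ σ τ h
    simp only [Term.rename, Term.subst]
    rw [ih (ρ.lift _) (σ.lift _) (τ.lift _)]
    intro C x
    cases x with
    | zero => rfl
    | succ x => simp [Ren.lift, Sub.lift, h]
  | app t s iht ihs =>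
    intro Δ Θ ρ σ τ h
    exact congrArg₂ Term.app (iht ρ σ τ h) (ihs ρ σ τ h)
  | pair t s iht ihs =>
    intro Δ Θ ρ σ τ h
    exact congrArg₂ Term.pair (iht ρ σ τ h) (ihs ρ σ τ h)
  | fst t ih => intro Δ Θ ρ σ τ h; exact congrArg Term.fst (ih ρ σ τ h)
  | snd t ih => intro Δ Θ ρ σ τ h; exact congrArg Term.snd (ih ρ σ τ h)
  | star => intros; rfl

theorem Term.rename_subst {Γ : List Ty} {A : Ty} (t : Term Γ A) :
    ∀ {Δ Θ : List Ty} (σ : Sub Γ Δ) (ρ : Ren Δ Θ) (τ : Sub Γ Θ),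
      (∀ C (x : Var Γ C), (σ _ x).rename ρ = τ _ x) → (t.subst σ).rename ρ = t.subst τ := by
  induction t with
  | var x => intro Δ Θ σ ρ τ h; simp [Term.subst, h]
  | lam t ih =>
    intro Δ Θ σ ρ τ h
    simp only [Term.rename, Term.subst]
    rw [ih (σ.lift _) (ρ.lift _) (τ.lift _)]
    intro C x
    cases x with
    | zero => rfl
    | succ x =>
      simp only [Sub.lift, ← h]
      exact Term.weaken_rename_lift _ _ _
  | app t s iht ihs =>
    intro Δ Θ σ ρ τ h
    exact congrArg₂ Term.app (iht σ ρ τ h) (ihs σ ρ τ h)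
  | pair t s iht ihs =>
    intro Δ Θ σ ρ τ h
    exact congrArg₂ Term.pair (iht σ ρ τ h) (ihs σ ρ τ h)
  | fst t ih => intro Δ Θ σ ρ τ h; exact congrArg Term.fst (ih σ ρ τ h)
  | snd t ih => intro Δ Θ σ ρ τ h; exact congrArg Term.snd (ih σ ρ τ h)
  | star => intros; rfl

theorem Term.weaken_subst_lift {Γ Δ : List Ty} {A : Ty} (t : Term Γ A) (σ : Sub Γ Δ) (B : Ty) :
    (t.weaken B).subst (σ.lift B) = (t.subst σ).weaken B :=
  (Term.subst_rename t _ _ _ fun _ _ => rfl).trans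
    (Term.rename_subst t σ (fun _ x => .succ x) (fun _ x => (σ _ x).weaken B) fun _ _ => rfl).symm

theorem Term.subst_subst {Γ : List Ty} {A : Ty} (t : Term Γ A) :
    ∀ {Δ Θ : List Ty} (σ : Sub Γ Δ) (σ' : Sub Δ Θ) (τ : Sub Γ Θ),
      (∀ C (x : Var Γ C), (σ _ x).subst σ' = τ _ x) → (t.subst σ).subst σ' = t.subst τ := by
  induction t with
  | var x => intro Δ Θ σ σ' τ h; simp [Term.subst, h]
  | lam t ih =>
    intro Δ Θ σ σ' τ h
    simp only [Term.subst]
    rw [ih (σ.lift _) (σ'.lift _) (τ.lift _)]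
    intro C x
    cases x with
    | zero => rfl
    | succ x =>
      simp only [Sub.lift, ← h]
      exact Term.weaken_subst_lift _ _ _
  | app t s iht ihs =>
    intro Δ Θ σ σ' τ h
    exact congrArg₂ Term.app (iht σ σ' τ h) (ihs σ σ' τ h)
  | pair t s iht ihs =>
    intro Δ Θ σ σ' τ h
    exact congrArg₂ Term.pair (iht σ σ' τ h) (ihs σ σ' τ h)
  | fst t ih => intro Δ Θ σ σ' τ h; exact congrArg Term.fst (ih σ σ' τ h)
  | snd t ih => intro Δ Θ σ σ' τ h; exact congrArg Term.snd (ih σ σ' τ h)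
  | star => intros; rfl

theorem Term.subst_id {Γ : List Ty} {A : Ty} (t : Term Γ A) :
    ∀ (σ : Sub Γ Γ), (∀ C (x : Var Γ C), σ _ x = .var x) → t.subst σ = t := by
  induction t with
  | var x => intro σ h; simp [Term.subst, h]
  | lam t ih =>
    intro σ h
    simp only [Term.subst]
    rw [ih (σ.lift _)]
    intro C x
    cases x with
    | zero => rfl
    | succ x => simp only [Sub.lift, h]; rfl
  | app t s iht ihs => intro σ h; exact congrArg₂ Term.app (iht σ h) (ihs σ h)
  | pair t s iht ihs => intro σ h; exact congrArg₂ Term.pair (iht σ h) (ihs σ h)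
  | fst t ih => intro σ h; exact congrArg Term.fst (ih σ h)
  | snd t ih => intro σ h; exact congrArg Term.snd (ih σ h)
  | star => intros; rfl

theorem Term.inst_weaken {Γ : List Ty} {A B : Ty} (t : Term Γ A) (s : Term Γ B) :
    (t.weaken B).inst s = t :=
  (Term.subst_rename t (fun _ x => .succ x) (Sub.single s) (fun _ x => .var x)
    fun _ _ => rfl).trans (t.subst_id _ fun _ _ => rfl)

theorem Term.inst_rename {Γ Δ : List Ty} {A B : Ty} (t : Term (B :: Γ) A) (s : Term Γ B)
    (ρ : Ren Γ Δ) : (t.inst s).rename ρ = (t.rename (ρ.lift B)).inst (s.rename ρ) := by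
  refine (Term.rename_subst t _ _ _ fun _ _ => rfl).trans
    (Term.subst_rename t _ _ _ fun C x => ?_).symm
  cases x with
  | zero => rfl
  | succ x => rfl

/-- The substitution of `s` for the most recent variable, the others being substituted by `σ`. -/
def Sub.cons {Γ Δ : List Ty} {B : Ty} (σ : Sub Γ Δ) (s : Term Δ B) : Sub (B :: Γ) Δ
  | _, .zero => s
  | _, .succ x => σ _ x

theorem Term.inst_subst_lift {Γ Δ : List Ty} {A B : Ty} (t : Term (B :: Γ) A) (σ : Sub Γ Δ)
    (s : Term Δ B) : (t.subst (σ.lift B)).inst s = t.subst (σ.cons s) := by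
  refine Term.subst_subst t _ _ _ fun C x => ?_
  cases x with
  | zero => rfl
  | succ x => exact Term.inst_weaken _ _

theorem Conv.rename {Γ : List Ty} {A : Ty} {t s : Term Γ A} (h : Conv t s) :
    ∀ {Δ : List Ty} (ρ : Ren Γ Δ), Conv (t.rename ρ) (s.rename ρ) := by
  induction h with
  | refl t => intro Δ ρ; exact .refl _
  | symm _ ih => intro Δ ρ; exact .symm (ih ρ)
  | trans _ _ ih ih' => intro Δ ρ; exact .trans (ih ρ) (ih' ρ)
  | lam _ ih => intro Δ ρ; exact .lam (ih _)
  | app _ _ ih ih' => intro Δ ρ; exact .app (ih ρ) (ih' ρ)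
  | pair _ _ ih ih' => intro Δ ρ; exact .pair (ih ρ) (ih' ρ)
  | fst _ ih => intro Δ ρ; exact .fst (ih ρ)
  | snd _ ih => intro Δ ρ; exact .snd (ih ρ)
  | beta t s => intro Δ ρ; rw [Term.inst_rename]; exact .beta _ _
  | eta t =>
    intro Δ ρ
    simp only [Term.rename]
    rw [Term.weaken_rename_lift]
    exact .eta _
  | beta_fst t s => intro Δ ρ; exact .beta_fst _ _
  | beta_snd t s => intro Δ ρ; exact .beta_snd _ _
  | eta_pair t => intro Δ ρ; exact .eta_pair _
  | eta_unit t => intro Δ ρ; exact .eta_unit _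

theorem Conv.of_eq {Γ : List Ty} {A : Ty} {t s : Term Γ A} (h : t = s) : Conv t s :=
  h ▸ .refl t

/-! ### Finite types and case distinctions -/

/-- The power `oⁿ`, as an iterated product that ends in the unit type. -/
def Ty.pow : ℕ → Ty
  | 0 => .unit
  | n + 1 => .prod .o (Ty.pow n)

/-- The type `oⁿ → o`, whose `n` projections encode the elements of `Fin n`. -/
def Ty.fin (n : ℕ) : Ty := .arr (Ty.pow n) .o

/-- The tuple in `oⁿ` with given entries. -/
def Term.tuple {Γ : List Ty} : (n : ℕ) → (Fin n → Term Γ .o) → Term Γ (Ty.pow n)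
  | 0, _ => .star
  | n + 1, k => .pair (k 0) (Term.tuple n fun i => k i.succ)

/-- The `i`-th entry of an element of `oⁿ`. -/
def Term.proj {Γ : List Ty} : (n : ℕ) → Fin n → Term Γ (Ty.pow n) → Term Γ .o
  | _ + 1, ⟨0, _⟩, t => .fst t
  | n + 1, ⟨i + 1, h⟩, t => Term.proj n ⟨i, Nat.lt_of_succ_lt_succ h⟩ (.snd t)

/-- The encoding of `i : Fin n` as the `i`-th projection. -/
def Term.fin {Γ : List Ty} (n : ℕ) (i : Fin n) : Term Γ (Ty.fin n) :=
  .lam (Term.proj n i (.var .zero))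

theorem Term.tuple_subst {Γ Δ : List Ty} (σ : Sub Γ Δ) :
    ∀ (n : ℕ) (k : Fin n → Term Γ .o),
      (Term.tuple n k).subst σ = Term.tuple n fun i => (k i).subst σ
  | 0, _ => rfl
  | n + 1, _ => congrArg (Term.pair _) (Term.tuple_subst σ n _)

theorem Term.proj_subst {Γ Δ : List Ty} (σ : Sub Γ Δ) :
    ∀ (n : ℕ) (i : Fin n) (t : Term Γ (Ty.pow n)),
      (Term.proj n i t).subst σ = Term.proj n i (t.subst σ)
  | _ + 1, ⟨0, _⟩, _ => rfl
  | n + 1, ⟨i + 1, h⟩, t => Term.proj_subst σ n ⟨i, Nat.lt_of_succ_lt_succ h⟩ (.snd t)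

theorem Term.proj_rename {Γ Δ : List Ty} (ρ : Ren Γ Δ) :
    ∀ (n : ℕ) (i : Fin n) (t : Term Γ (Ty.pow n)),
      (Term.proj n i t).rename ρ = Term.proj n i (t.rename ρ)
  | _ + 1, ⟨0, _⟩, _ => rfl
  | n + 1, ⟨i + 1, h⟩, t => Term.proj_rename ρ n ⟨i, Nat.lt_of_succ_lt_succ h⟩ (.snd t)

theorem Term.fin_subst {Γ Δ : List Ty} (σ : Sub Γ Δ) (n : ℕ) (i : Fin n) :
    (Term.fin n i).subst σ = Term.fin n i :=
  congrArg Term.lam (Term.proj_subst _ n i _)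

theorem Term.fin_weaken {Γ : List Ty} (B : Ty) (n : ℕ) (i : Fin n) :
    (Term.fin (Γ := Γ) n i).weaken B = Term.fin n i :=
  congrArg Term.lam (Term.proj_rename _ n i _)

theorem Conv.proj {Γ : List Ty} :
    ∀ (n : ℕ) (i : Fin n) {t s : Term Γ (Ty.pow n)}, Conv t s →
      Conv (Term.proj n i t) (Term.proj n i s)
  | _ + 1, ⟨0, _⟩, _, _, h => .fst h
  | n + 1, ⟨i + 1, hi⟩, _, _, h => Conv.proj n ⟨i, Nat.lt_of_succ_lt_succ hi⟩ (.snd h)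

theorem Conv.proj_tuple {Γ : List Ty} :
    ∀ (n : ℕ) (i : Fin n) (k : Fin n → Term Γ .o), Conv (Term.proj n i (Term.tuple n k)) (k i)
  | _ + 1, ⟨0, _⟩, _ => .beta_fst _ _
  | n + 1, ⟨i + 1, hi⟩, k =>
    .trans (Conv.proj n ⟨i, Nat.lt_of_succ_lt_succ hi⟩ (.beta_snd _ _))
      (Conv.proj_tuple n ⟨i, Nat.lt_of_succ_lt_succ hi⟩ fun j => k j.succ)

/-- Case distinction on an element `t` of `oⁿ → o`, with branches `k i` in an arbitrary type `D`.
Since `t` only returns elements of `o`, the distinction is η-expanded along `D`. -/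
def Term.select {n : ℕ} :
    (D : Ty) → {Γ : List Ty} → Term Γ (Ty.fin n) → (Fin n → Term Γ D) → Term Γ D
  | .o, _, t, k => .app t (Term.tuple n k)
  | .arr A D, _, t, k =>
    .lam (Term.select D (t.weaken A) fun i => .app ((k i).weaken A) (.var .zero))
  | .prod D E, _, t, k =>
    .pair (Term.select D t fun i => .fst (k i)) (Term.select E t fun i => .snd (k i))
  | .unit, _, _, _ => .star

theorem Term.select_subst {n : ℕ} (D : Ty) :
    ∀ {Γ Δ : List Ty} (σ : Sub Γ Δ) (t : Term Γ (Ty.fin n)) (k : Fin n → Term Γ D),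
      (Term.select D t k).subst σ = Term.select D (t.subst σ) fun i => (k i).subst σ := by
  induction D with
  | o => intro Γ Δ σ t k; exact congrArg (Term.app _) (Term.tuple_subst _ _ _)
  | arr A D _ ih =>
    intro Γ Δ σ t k
    simp only [Term.select, Term.subst, ih, Term.weaken_subst_lift]
    rfl
  | prod D E ihD ihE => intro Γ Δ σ t k; simp [Term.select, Term.subst, ihD, ihE]
  | unit => intros; rfl

theorem Conv.select {n : ℕ} (i : Fin n) (D : Ty) :
    ∀ {Γ : List Ty} {t : Term Γ (Ty.fin n)} (k : Fin n → Term Γ D), Conv t (Term.fin n i) →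
      Conv (Term.select D t k) (k i) := by
  induction D with
  | o =>
    intro Γ t k h
    refine .trans (.app h (.refl _)) (.trans (.beta _ _) ?_)
    rw [Term.inst, Term.proj_subst]
    exact Conv.proj_tuple n i k
  | arr A D _ ih =>
    intro Γ t k h
    refine .trans (.lam (ih _ ?_)) (.eta _)
    have h' := h.rename (fun _ x => Var.succ (B := A) x)
    rwa [← Term.weaken, ← Term.weaken, Term.fin_weaken] at h'
  | prod D E ihD ihE =>
    intro Γ t k h
    exact .trans (.pair (ihD _ h) (ihE _ h)) (.eta_pair _)
  | unit => intro Γ t k h; exact .eta_unit _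

/-! ### Definability and inspection of elements of the interpretation -/

instance Ty.finite_den (Q : Type u) [Finite Q] : (A : Ty) → Finite (Ty.den Q A)
  | .o => inferInstanceAs (Finite Q)
  | .arr A C =>
    have := Ty.finite_den Q A
    have := Ty.finite_den Q C
    inferInstanceAs (Finite (Ty.den Q A → Ty.den Q C))
  | .prod A C =>
    have := Ty.finite_den Q A
    have := Ty.finite_den Q C
    inferInstanceAs (Finite (Ty.den Q A × Ty.den Q C))
  | .unit => inferInstanceAs (Finite PUnit)

/-- The type `B` whose projections encode the elements of `Q`. -/
noncomputable abbrev Ty.code (Q : Type u) : Ty := Ty.fin (Nat.card Q)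

/-- If `test i` passes a value `y i : Y` to its continuation, then `collect test` passes the
function `y` to its continuation. -/
def collect {Y : Type*} {T : Type*} :
    {n : ℕ} → (Fin n → (Y → T) → T) → ((Fin n → Y) → T) → T
  | 0, _, k => k Fin.elim0
  | _ + 1, test, k => test 0 fun y => collect (fun i => test i.succ) fun g => k (Fin.cons y g)

mutual

/-- A term of type `A[B]` that defines the element `a` of `⟦A⟧_Q`. -/
noncomputable def quote (Q : Type u) [Finite Q] :
    (A : Ty) → {Γ : List Ty} → Ty.den Q A → Term Γ (Ty.cast (Ty.code Q) A)
  | .o, _, q => Term.fin _ (Finite.equivFin Q q)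
  | .arr A C, _, f => .lam (caseOf Q A (.var .zero) fun a => quote Q C (f a))
  | .prod A C, _, p => .pair (quote Q A p.1) (quote Q C p.2)
  | .unit, _, _ => .star

/-- Case distinction on the element of `⟦A⟧_Q` defined by a term of type `A[B]`, with branches in
an arbitrary type `D`. -/
noncomputable def caseOf (Q : Type u) [Finite Q] :
    (A : Ty) → {Γ : List Ty} → {D : Ty} → Term Γ (Ty.cast (Ty.code Q) A) →
      (Ty.den Q A → Term Γ D) → Term Γ D
  | .o, _, D, t, k => Term.select D t fun i => k ((Finite.equivFin Q).symm i)
  | .arr A C, _, _, t, k =>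
    collect (n := Nat.card (Ty.den Q A))
      (fun i => caseOf Q C (.app t (quote Q A ((Finite.equivFin (Ty.den Q A)).symm i))))
      fun g => k fun a => g (Finite.equivFin (Ty.den Q A) a)
  | .prod A C, _, _, t, k =>
    caseOf Q A (.fst t) fun a => caseOf Q C (.snd t) fun c => k (a, c)
  | .unit, _, _, _, k => k PUnit.unit

end

/-- `collect` commutes with every map with which the individual tests commute. -/
theorem collect_map {Y T T' : Type*} (φ : T → T') :
    ∀ {n : ℕ} (test : Fin n → (Y → T) → T) (test' : Fin n → (Y → T') → T'),
      (∀ i k, φ (test i k) = test' i fun y => φ (k y)) →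
      ∀ k, φ (collect test k) = collect test' fun g => φ (k g)
  | 0, _, _, _, _ => rfl
  | _ + 1, _, _, h, _ => by
    simp only [collect, h]
    congr 1
    funext y
    exact collect_map φ _ _ (fun i => h i.succ) _

theorem conv_collect {Y : Type*} {Γ : List Ty} {D : Ty} :
    ∀ {n : ℕ} (test : Fin n → (Y → Term Γ D) → Term Γ D) (y : Fin n → Y),
      (∀ i k, Conv (test i k) (k (y i))) → ∀ k, Conv (collect test k) (k y)
  | 0, _, _, _, k => .of_eq (congrArg k (Subsingleton.elim _ _))
  | _ + 1, _, y, h, k =>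
    (h 0 _).trans ((conv_collect _ (fun i => y i.succ) (fun i => h i.succ) _).trans
      (.of_eq (congrArg k (Fin.cons_self_tail y))))

theorem quote_caseOf_subst (Q : Type u) [Finite Q] (A : Ty) :
    (∀ {Γ Δ : List Ty} (σ : Sub Γ Δ) (a : Ty.den Q A),
      (quote Q A a).subst σ = quote Q A a) ∧
    (∀ {Γ Δ : List Ty} {D : Ty} (σ : Sub Γ Δ) (t : Term Γ (Ty.cast (Ty.code Q) A))
      (k : Ty.den Q A → Term Γ D),
      (caseOf Q A t k).subst σ = caseOf Q A (t.subst σ) fun a => (k a).subst σ) := by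
  induction A with
  | o =>
    refine ⟨fun σ q => ?_, fun σ t k => ?_⟩
    · simp only [quote]
      exact Term.fin_subst _ _ _
    · simp only [caseOf]
      exact Term.select_subst _ _ _ _
  | arr A C ihA ihC =>
    refine ⟨fun σ f => ?_, fun σ t k => ?_⟩
    · simp only [quote, Term.subst]
      rw [ihA.2]
      simp only [ihC.1]
      rfl
    · simp only [caseOf]
      refine collect_map _ _ _ (fun i k => ?_) _
      rw [ihC.2]
      exact congrArg (fun u => caseOf Q C (.app _ u) _) (ihA.1 _ _)
  | prod A C ihA ihC =>
    refine ⟨fun σ p => ?_, fun σ t k => ?_⟩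
    · simp only [quote]
      exact congrArg₂ Term.pair (ihA.1 _ _) (ihC.1 _ _)
    · simp only [caseOf, ihA.2, ihC.2]
      rfl
  | unit => exact ⟨fun _ _ => by simp only [quote]; rfl, fun _ _ _ => by simp only [caseOf]⟩

/-! ### The logical relation -/

/-- The logical relation between elements of `⟦A⟧_Q` and terms of type `A[B]`, over a fixed
context. -/
def Rel (Q : Type u) [Finite Q] {Γ : List Ty} :
    (A : Ty) → Ty.den Q A → Term Γ (Ty.cast (Ty.code Q) A) → Prop
  | .o, q, t => Conv t (Term.fin _ (Finite.equivFin Q q))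
  | .arr A C, f, t => ∀ a u, Rel Q A a u → Rel Q C (f a) (.app t u)
  | .prod A C, p, t => Rel Q A p.1 (.fst t) ∧ Rel Q C p.2 (.snd t)
  | .unit, _, _ => True

theorem Rel.conv {Q : Type u} [Finite Q] {Γ : List Ty} {A : Ty} :
    ∀ {a : Ty.den Q A} {t s : Term Γ (Ty.cast (Ty.code Q) A)}, Conv s t → Rel Q A a t →
      Rel Q A a s := by
  induction A with
  | o => intro a t s h ht; exact Conv.trans h ht
  | arr A C _ ih => intro a t s h ht b u hu; exact ih (.app h (.refl _)) (ht b u hu)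
  | prod A C ihA ihC => intro a t s h ht; exact ⟨ihA (.fst h) ht.1, ihC (.snd h) ht.2⟩
  | unit => intros; trivial

/-- Quotations are related to what they quote, and case distinctions find the element to which
their argument is related. The two facts depend on each other at arrow types. -/
theorem rel_quote_and_conv_caseOf (Q : Type u) [Finite Q] (A : Ty) {Γ : List Ty} :
    (∀ a : Ty.den Q A, Rel Q (Γ := Γ) A a (quote Q A a)) ∧
    (∀ {D : Ty} (a : Ty.den Q A) (t : Term Γ (Ty.cast (Ty.code Q) A)) (k : Ty.den Q A → Term Γ D),
      Rel Q A a t → Conv (caseOf Q A t k) (k a)) := by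
  induction A with
  | o =>
    refine ⟨fun q => ?_, fun q t k h => ?_⟩
    · simp only [quote]
      exact Conv.refl _
    · simp only [caseOf]
      refine .trans (Conv.select _ _ _ h) (.of_eq ?_)
      exact congrArg k (Equiv.symm_apply_apply _ q)
  | arr A C ihA ihC =>
    refine ⟨fun f a u hu => ?_, fun f t k h => ?_⟩
    · refine Rel.conv ?_ (ihC.1 (f a))
      simp only [quote]
      refine .trans (.beta _ _) ?_
      rw [Term.inst, (quote_caseOf_subst Q A).2]
      simp only [(quote_caseOf_subst Q C).1]
      exact ihA.2 a u (fun a => quote Q C (f a)) hu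
    · simp only [caseOf]
      refine .trans (conv_collect _ (fun i => f ((Finite.equivFin (Ty.den Q A)).symm i))
        (fun i k => ihC.2 _ _ _ (h _ _ (ihA.1 _))) _) (.of_eq ?_)
      simp only [Equiv.symm_apply_apply]
  | prod A C ihA ihC =>
    refine ⟨fun p => ?_, fun p t k h => ?_⟩
    · simp only [quote]
      exact ⟨Rel.conv (.beta_fst _ _) (ihA.1 _), Rel.conv (.beta_snd _ _) (ihC.1 _)⟩
    · simp only [caseOf]
      exact .trans (ihA.2 _ _ _ h.1) (ihC.2 _ _ _ h.2)
  | unit => exact ⟨fun _ => trivial, fun _ _ _ _ => by simp only [caseOf]; exact .refl _⟩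

/-- The fundamental lemma of the logical relation, for open terms. -/
theorem rel_den_cast_subst (Q : Type u) [Finite Q] {Γ : List Ty} {A : Ty} (t : Term Γ A)
    {Δ : List Ty} :
    ∀ (e : Env Q Γ) (σ : Sub (Γ.map (Ty.cast (Ty.code Q))) Δ),
      (∀ C (x : Var Γ C), Rel Q C (e _ x) (σ _ (Var.cast _ x))) →
      Rel Q A (Term.den Q t e) ((Term.cast (Ty.code Q) t).subst σ) := by
  induction t with
  | var x => intro e σ h; exact h _ x
  | lam t ih =>
    intro e σ h a u hu
    refine Rel.conv (.beta _ _) ?_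
    rw [Term.inst_subst_lift]
    refine ih (e.cons a) (σ.cons u) fun C x => ?_
    cases x with
    | zero => exact hu
    | succ x => exact h _ x
  | app t s iht ihs => intro e σ h; exact iht e σ h _ _ (ihs e σ h)
  | pair t s iht ihs =>
    intro e σ h
    exact ⟨Rel.conv (.beta_fst _ _) (iht e σ h), Rel.conv (.beta_snd _ _) (ihs e σ h)⟩
  | fst t ih => intro e σ h; exact (ih e σ h).1
  | snd t ih => intro e σ h; exact (ih e σ h).2
  | star => intros; trivial

theorem rel_den_cast (Q : Type u) [Finite Q] {A : Ty} (t : Term [] A) :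
    Rel Q (Γ := []) A (Term.den Q t (Env.nil Q)) (Term.cast (Ty.code Q) t) := by
  have h := rel_den_cast_subst Q t (Env.nil Q) (fun _ x => .var x) fun _ x => nomatch x
  rwa [Term.subst_id _ _ fun _ _ => rfl] at h

/-! ### The recognizing term -/

/-- The Boolean "false", the second projection. -/
def Tm.ff : Tm Ty.bool := Tm.mk (.lam (.snd (.var .zero)))

/-- The two Booleans have different interpretations at a two-element set. -/
theorem Tm.ff_ne_tt : Tm.ff ≠ Tm.tt := fun h =>
  Bool.false_ne_true
    (congrFun (congrArg (Tm.den Bool) h : (fun p : Bool × Bool => p.2) = fun p => p.1)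
      (true, false))

open Classical in
/-- The Boolean constant telling whether `a` lies in `F`. -/
noncomputable def memTerm {X : Type u} (F : Set X) {Γ : List Ty} (a : X) : Term Γ Ty.bool :=
  if a ∈ F then .lam (.fst (.var .zero)) else .lam (.snd (.var .zero))

theorem memTerm_of_mem {X : Type u} {F : Set X} {Γ : List Ty} {a : X} (h : a ∈ F) :
    memTerm (Γ := Γ) F a = .lam (.fst (.var .zero)) :=
  if_pos h

theorem memTerm_of_notMem {X : Type u} {F : Set X} {Γ : List Ty} {a : X} (h : a ∉ F) :
    memTerm (Γ := Γ) F a = .lam (.snd (.var .zero)) :=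
  if_neg h

theorem memTerm_subst {X : Type u} (F : Set X) {Γ Δ : List Ty} (σ : Sub Γ Δ) (a : X) :
    (memTerm F a).subst σ = memTerm F a := by
  by_cases h : a ∈ F
  · rw [memTerm_of_mem h, memTerm_of_mem h]
    rfl
  · rw [memTerm_of_notMem h, memTerm_of_notMem h]
    rfl

theorem mk_memTerm_eq_tt {X : Type u} (F : Set X) (a : X) :
    Tm.mk (memTerm F a) = Tm.tt ↔ a ∈ F := by
  by_cases h : a ∈ F
  · rw [memTerm_of_mem h]
    exact iff_of_true rfl h
  · rw [memTerm_of_notMem h]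
    exact iff_of_false Tm.ff_ne_tt h

end STLC

/-- Every language of closed simply typed terms that is recognized by finite sets is syntactically
recognizable. -/
theorem mainTheorem1 {A : STLC.Ty} (L : Set (STLC.Tm A))
    (hL : STLC.FinSetRecognizable.{u} L) : STLC.SyntacticallyRecognizable L := by
  open STLC in
  obtain ⟨Q, _, F, rfl⟩ := hL
  refine ⟨Ty.code Q, Tm.mk (.lam (caseOf Q A (.var .zero) (memTerm F))), ?_⟩
  ext t
  induction t using Quotient.inductionOn with
  | h t =>
    have key : Conv (.app (.lam (caseOf Q A (.var .zero) (memTerm F))) (Term.cast (Ty.code Q) t))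
        (memTerm F (Term.den Q t (Env.nil Q))) := by
      refine .trans (.beta _ _) ?_
      rw [Term.inst, (quote_caseOf_subst Q A).2]
      simp only [memTerm_subst]
      exact (rel_quote_and_conv_caseOf Q A).2 _ _ (memTerm F) (rel_den_cast Q t)
    exact (mk_memTerm_eq_tt F _).symm.trans
      (Eq.congr_left (Quotient.sound (s := convSetoid _) key).symm)
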